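/- Let $\varphi(t)=\min_{m\in\mathbb Z}|t-m|$ be the distance from $t\in\mathbb R$ to the nearest integer, and let $\varphi_n(t)=2^{-n}\varphi(2^n t)$ for integers $n\ge 0$. Put $n_k=\lfloor \log_2\log_2(k+1)\rfloor$ for integers $k\ge 1$, and define the "shark teeth" $$M=\big([0,1]\times\{0\}\big)\cup\bigcup_{k=1}^{\infty}\Big\{\big(t,\tfrac1k\,\varphi_{n_k}(t)\big): t\in[0,1]\Big\}\subset\mathbb R^2$$ with the subspace topology. An IFS on a metric space $Y$ is a finite family $\mathcal F$ of self-maps of $Y$, each Lipschitz with a constant $<1$; its attractor is the nonempty compact set $A\subset Y$ with $A=\bigcup_{f\in\mathcal F}f(A)$ (unique when it exists), and such an $A$ is called an IFS-attractor. A Banach fractal is a compact metrizable space homeomorphic to the attractor of an IFS on a complete metric space. A Hausdorff space $X$ is a topological fractal if there is a finite family $\mathcal F$ of continuous self-maps of $X$ with $X=\bigcup_{f\in\mathcal F}f(X)$ such that for every open cover $\mathcal U$ of $X$ there is $n\in\mathbb N$ such that for all $f_1,\dots,f_n\in\mathcal F$ the set $f_1\circ\dots\circ f_n(X)$ is contained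 in some $U\in\mathcal U$. **Theorem.** The space $M$ is a Peano continuum (a Hausdorff continuous image of $[0,1]$) and a topological fractal, but it is not homeomorphic to any IFS-attractor (in any metric space); in particular, it is not a Banach fractal. -/

import Mathlib

universe u v

noncomputable section

/-- The sawtooth function `φ : ℝ → ℝ` (distance to the nearest integer); the lemmas
`sawtooth_of_mem_Icc_right` and `sawtooth_of_mem_Icc_left` give its piecewise linear formula. -/
def sawtooth (t : ℝ) : ℝ := |t - round t|

theorem sawtooth_of_mem_Icc_right (n : ℤ) (t : ℝ) (ht : t ∈ Set.Icc (n : ℝ) (n + 1 / 2)) :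
    sawtooth t = t - n := by
  obtain ⟨h1, h2⟩ := ht
  have hf : ⌊t⌋ = n := Int.floor_eq_iff.2 ⟨h1, by linarith⟩
  rw [sawtooth, abs_sub_round_eq_min, Int.fract, hf, min_eq_left (by linarith)]

theorem sawtooth_of_mem_Icc_left (n : ℤ) (t : ℝ) (ht : t ∈ Set.Icc (n - 1 / 2 : ℝ) n) :
    sawtooth t = n - t := by
  obtain ⟨h1, h2⟩ := ht
  rcases eq_or_lt_of_le h2 with rfl | h2
  · simp [sawtooth]
  have hf : ⌊t⌋ = n - 1 := Int.floor_eq_iff.2 ⟨by push_cast; linarith, by push_cast; linarith⟩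
  rw [sawtooth, abs_sub_round_eq_min, Int.fract, hf]
  push_cast
  rw [min_eq_right (by linarith)]
  ring

/-- The rescaled copy `φ_n(t) = 2⁻ⁿ φ(2ⁿ t)` of the sawtooth function. -/
def scaledSawtooth (n : ℕ) (t : ℝ) : ℝ := ((2 : ℝ) ^ n)⁻¹ * sawtooth ((2 : ℝ) ^ n * t)

/-- The bone `I = [0,1] × {0}` of the shark teeth. -/
def sharkBone : Set (ℝ × ℝ) := Set.Icc (0 : ℝ) 1 ×ˢ {(0 : ℝ)}

/-- The `k`-th row `M_k = {(t, (1/k) φ_{n_k}(t)) : t ∈ [0,1]}` of teeth (used for `k ≥ 1`). -/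
def sharkRow (n : ℕ → ℕ) (k : ℕ) : Set (ℝ × ℝ) :=
  (fun t : ℝ => (t, 1 / (k : ℝ) * scaledSawtooth (n k) t)) '' Set.Icc (0 : ℝ) 1

/-- The shark teeth `M = I ∪ ⋃_{k ≥ 1} M_k` given by a sequence `(n_k)_{k ≥ 1}`,
as a subset of the plane. The value `n 0` is not used. -/
def sharkTeeth (n : ℕ → ℕ) : Set (ℝ × ℝ) :=
  sharkBone ∪ ⋃ k ∈ Set.Ici (1 : ℕ), sharkRow n k

/-- The sequence `n_k = ⌊log₂ log₂ (k+1)⌋`, `k ≥ 1`. The iterated logarithm is nonnegative for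
`k ≥ 1`, so the natural-number floor is the integer part. -/
def sharkExponent (k : ℕ) : ℕ := ⌊Real.logb 2 (Real.logb 2 ((k : ℝ) + 1))⌋₊

end

/-- A Peano continuum: a Hausdorff space which is a continuous image of `[0,1]`. -/
def IsPeanoContinuum (X : Type u) [TopologicalSpace X] : Prop :=
  T2Space X ∧ ∃ p : Set.Icc (0 : ℝ) 1 → X, Continuous p ∧ Function.Surjective p

/-- An iterated function system on a metric space: a finite family of self-maps, each of them
Lipschitz with a constant `< 1`. -/
def IsIFS {Y : Type v} [MetricSpace Y] (F : Set (Y → Y)) : Prop :=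
  F.Finite ∧ ∀ f ∈ F, ∃ K : NNReal, ContractingWith K f

/-- `A` is the attractor of the IFS `F`: a nonempty compact set with `A = ⋃_{f ∈ F} f(A)`.
(There is at most one such set, since `F` contracts the Hausdorff distance.) -/
def IsAttractor {Y : Type v} [MetricSpace Y] (F : Set (Y → Y)) (A : Set Y) : Prop :=
  A.Nonempty ∧ IsCompact A ∧ A = ⋃ f ∈ F, f '' A

/-- A Banach fractal: a compact metrizable space homeomorphic to the attractor of an IFS on a
complete metric space. -/
def IsBanachFractal (X : Type u) [TopologicalSpace X] : Prop :=
  CompactSpace X ∧ TopologicalSpace.MetrizableSpace X ∧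
    ∃ (Y : Type v) (_ : MetricSpace Y) (_ : CompleteSpace Y) (F : Set (Y → Y)) (A : Set Y),
      IsIFS F ∧ IsAttractor F A ∧ Nonempty (X ≃ₜ A)

/-- A topological fractal: a Hausdorff space `X` with a finite family `F` of continuous self-maps
such that `X = ⋃_{f ∈ F} f(X)` and, for every open cover `𝒰` of `X`, there is `n` such that for
all `f₁, …, fₙ ∈ F` the set `f₁ ∘ ⋯ ∘ fₙ (X)` lies in a member of `𝒰`. -/
def IsTopologicalFractal (X : Type u) [TopologicalSpace X] : Prop :=
  T2Space X ∧
    ∃ F : Set (X → X), F.Finite ∧ (∀ f ∈ F, Continuous f) ∧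
      (Set.univ : Set X) = ⋃ f ∈ F, Set.range f ∧
      ∀ 𝒰 : Set (Set X), (∀ U ∈ 𝒰, IsOpen U) → ⋃₀ 𝒰 = Set.univ →
        ∃ n : ℕ, ∀ l : List (X → X), l.length = n → (∀ f ∈ l, f ∈ F) →
          ∃ U ∈ 𝒰, Set.range (l.foldr (fun f g => f ∘ g) id) ⊆ U

/-! Peano continuum. The rows are swept one at a time by deforming the bone. For s near 4⁻ʲ,
`rowExcursion` pushes the bone into its union with one row, moving no point further than 2⁻ⁿ, where
n is the exponent of that row. Since exponents tend to infinity, these displacements, disjointly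
supported in s, sum to a continuous map of the square onto the teeth. A space-filling curve turns it
into a path (`exists_path_onto_teeth`).

Topological fractal. A map r to [0,1] vanishes off the first row and equals 2φ along it. One path
onto the bone and the rows k ≥ 2, where r = 0, and the four quarters of the first row cover M; along
each of these five paths r is 1/2-Lipschitz in the parameter. Following r by these paths gives five
self-maps whose long compositions have small images (`isTopologicalFractal_of_paths`).

No IFS. An attractor of s contractions with constant c is covered by sᵐ connected pieces of diameter
O(cᵐ). With m proportional to N the pieces are smaller than a fixed fraction of 2⁻ᴺ, and there are
only 2^O(N) of them. But 2^(2^N) rows have exponent N. Some dyadic interval of length 2⁻ᴺ has ends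
at image distance at least δ/2ᴺ, where δ is the image distance of the ends of the bone. Over it each
of these rows contains a point far from both ends, and a connected piece avoiding both ends cannot
meet two of the rows (`not_isPreconnected_of_mem_rows`). So 2^(2^N) pieces are needed
(`two_pow_two_pow_le_card`), a contradiction for large N. -/

/-! ### Elementary properties of the sawtooth and its dyadic rescalings. -/

theorem sawtooth_nonneg (t : ℝ) : 0 ≤ sawtooth t := abs_nonneg _

theorem sawtooth_le_half (t : ℝ) : sawtooth t ≤ 1 / 2 := abs_sub_round t

theorem sawtooth_le_abs_sub (t : ℝ) (m : ℤ) : sawtooth t ≤ |t - m| := round_le t m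

theorem sawtooth_le_self {t : ℝ} (ht : 0 ≤ t) : sawtooth t ≤ t := by
  simpa [abs_of_nonneg ht] using sawtooth_le_abs_sub t 0

theorem sawtooth_add_int (t : ℝ) (m : ℤ) : sawtooth (t + m) = sawtooth t := by
  simp [sawtooth]

theorem sawtooth_int (m : ℤ) : sawtooth m = 0 := by
  simp [sawtooth]

theorem sawtooth_zero : sawtooth 0 = 0 := by
  simp [sawtooth]

theorem abs_sawtooth_sub_le (s t : ℝ) : |sawtooth s - sawtooth t| ≤ |s - t| := by
  -- The sawtooth is the norm of ℝ/ℤ, so the bound is the reverse triangle inequality.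
  have h : ∀ u : ℝ, sawtooth u = ‖(u : UnitAddCircle)‖ := fun u => by
    rw [UnitAddCircle.norm_eq, sawtooth]
  have h2 : sawtooth (s - t) ≤ |s - t| := by simpa using sawtooth_le_abs_sub (s - t) 0
  refine le_trans ?_ h2
  rw [h, h, h, AddCircle.coe_sub]
  exact abs_norm_sub_norm_le _ _

theorem continuous_sawtooth : Continuous sawtooth :=
  (LipschitzWith.of_dist_le_mul (K := 1) fun s t => by
    simpa [Real.dist_eq] using abs_sawtooth_sub_le s t).continuous

theorem sawtooth_two_mul_le (t : ℝ) : sawtooth (2 * t) ≤ 2 * sawtooth t := by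
  have h := sawtooth_le_abs_sub (2 * t) (2 * round t)
  have h2 : |2 * t - ((2 * round t : ℤ) : ℝ)| = 2 * sawtooth t := by
    rw [sawtooth, ← abs_two (α := ℝ), ← abs_mul, abs_two]
    push_cast
    ring_nf
  linarith

theorem sawtooth_pos_of_mem_Ioo {i : ℤ} {t : ℝ} (ht : t ∈ Set.Ioo (i : ℝ) (i + 1)) :
    0 < sawtooth t := by
  refine abs_pos.2 fun h => ?_
  have h1 : (i : ℝ) < round t := by linarith [ht.1]
  have h2 : (round t : ℝ) < i + 1 := by linarith [ht.2]
  norm_cast at h1 h2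
  omega

theorem continuous_scaledSawtooth (n : ℕ) : Continuous (scaledSawtooth n) :=
  continuous_const.mul (continuous_sawtooth.comp (continuous_const.mul continuous_id))

theorem scaledSawtooth_nonneg (n : ℕ) (t : ℝ) : 0 ≤ scaledSawtooth n t :=
  mul_nonneg (by positivity) (sawtooth_nonneg _)

theorem scaledSawtooth_zero (t : ℝ) : scaledSawtooth 0 t = sawtooth t := by
  simp [scaledSawtooth]

theorem scaledSawtooth_le_self (n : ℕ) {t : ℝ} (ht : 0 ≤ t) : scaledSawtooth n t ≤ t := by
  rw [scaledSawtooth, inv_mul_le_iff₀ (by positivity)]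
  exact sawtooth_le_self (by positivity)

/-- Rows with a larger exponent lie lower. This makes r vanish off the first row, and keeps every
row on its side of the separating graph in `not_isPreconnected_of_mem_rows`. -/
theorem scaledSawtooth_antitone (t : ℝ) : Antitone fun n => scaledSawtooth n t := by
  refine antitone_nat_of_succ_le fun n => ?_
  have h := sawtooth_two_mul_le ((2 : ℝ) ^ n * t)
  have hp : (0 : ℝ) < 2 ^ n := by positivity
  simp only [scaledSawtooth, pow_succ]
  rw [mul_inv, mul_assoc, mul_comm ((2 : ℝ) ^ n) 2, mul_assoc]
  exact mul_le_mul_of_nonneg_left (by linarith) (by positivity)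

theorem scaledSawtooth_div (n : ℕ) (i : ℤ) : scaledSawtooth n (i / 2 ^ n) = 0 := by
  rw [scaledSawtooth, mul_div_cancel₀ _ (by positivity), sawtooth_int, mul_zero]

theorem scaledSawtooth_div_add (n : ℕ) (i : ℤ) (w : ℝ) :
    scaledSawtooth n (i / 2 ^ n + w) = scaledSawtooth n w := by
  rw [scaledSawtooth, scaledSawtooth, mul_add, mul_div_cancel₀ _ (by positivity), add_comm,
    sawtooth_add_int]

theorem scaledSawtooth_pos {n : ℕ} {i : ℤ} {t : ℝ}
    (ht : t ∈ Set.Ioo ((i : ℝ) / 2 ^ n) ((i + 1) / 2 ^ n)) : 0 < scaledSawtooth n t := by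
  have hp : (0 : ℝ) < 2 ^ n := by positivity
  refine mul_pos (by positivity) (sawtooth_pos_of_mem_Ioo (i := i) ⟨?_, ?_⟩)
  · have := ht.1
    rwa [div_lt_iff₀ hp, mul_comm] at this
  · have := ht.2
    rwa [lt_div_iff₀ hp, mul_comm] at this

/-! ### A space-filling curve and sums with disjoint supports. -/

/-- There is a continuous surjection of the unit interval onto the unit square. -/
theorem exists_continuous_surjective_unitInterval_prod :
    ∃ f : unitInterval → unitInterval × unitInterval, Continuous f ∧ Function.Surjective f := by
  obtain ⟨g, hg, hgs⟩ :=
    exists_nat_bool_continuous_surjective_of_compact (unitInterval × unitInterval)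
  let e : (ℕ → Bool) → unitInterval := fun b =>
    ⟨cantorSetHomeomorphNatToBool.symm b, cantorSet_subset_unitInterval (Subtype.property _)⟩
  have he : Topology.IsClosedEmbedding e := by
    refine Continuous.isClosedEmbedding ?_ ?_
    · exact (continuous_subtype_val.comp (Homeomorph.continuous _)).subtype_mk _
    · intro a b hab
      exact cantorSetHomeomorphNatToBool.symm.injective (Subtype.ext (Subtype.mk.inj hab))
  -- Tietze's theorem extends the surjection from the Cantor set to the whole interval.
  obtain ⟨F, hF⟩ := ContinuousMap.exists_extension' he ⟨g, hg⟩
  refine ⟨F, F.continuous, fun y => ?_⟩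
  obtain ⟨b, rfl⟩ := hgs y
  exact ⟨e b, congrFun hF b⟩

/-- A sum of continuous functions with pairwise disjoint supports and sup-norms tending to zero is
continuous. -/
theorem continuous_tsum_of_disjoint_support {X E : Type*} [TopologicalSpace X]
    [NormedAddCommGroup E] {G : ℕ → X → E} {b : ℕ → ℝ} (hG : ∀ k, Continuous (G k))
    (hb : Filter.Tendsto b Filter.atTop (nhds 0)) (hGb : ∀ k x, ‖G k x‖ ≤ b k)
    (hd : ∀ x j k, G j x ≠ 0 → G k x ≠ 0 → j = k) :
    Continuous fun x => ∑' k, G k x := by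
  refine continuous_of_uniform_approx_of_continuous fun u hu => ?_
  obtain ⟨ε, hε, hεu⟩ := Metric.mem_uniformity_dist.1 hu
  obtain ⟨N, hN⟩ := Filter.eventually_atTop.1 (hb.eventually (gt_mem_nhds hε))
  refine ⟨fun x => ∑ k ∈ Finset.range N, G k x, continuous_finsetSum _ fun k _ => hG k,
    fun x => hεu ?_⟩
  by_cases hx : ∃ k, G k x ≠ 0
  · obtain ⟨k, hk⟩ := hx
    have h0 : ∀ j, j ≠ k → G j x = 0 := fun j hj => by
      by_contra h
      exact hj (hd x j k h hk)
    rw [tsum_eq_single k h0]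
    change dist _ (∑ j ∈ Finset.range N, G j x) < ε
    by_cases hkN : k < N
    · rw [Finset.sum_eq_single_of_mem k (Finset.mem_range.2 hkN) fun j _ hj => h0 j hj]
      simpa using hε
    · rw [Finset.sum_eq_zero fun j hj => h0 j (by rintro rfl; exact hkN (Finset.mem_range.1 hj)),
        dist_zero_right]
      exact (hGb k x).trans_lt (hN k (not_lt.1 hkN))
  · push Not at hx
    simpa [hx] using hε

/-! ### Sweeping the teeth by deformations of the bone. -/

noncomputable section

/-- A continuous periodic function climbing from `0` to `1` on `[i, i + 1/4]`, returning to `0` on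
`[i + 1/4, i + 1/2]` and vanishing on `[i + 1/2, i + 1]`, for every integer `i`. -/
def halfTent (u : ℝ) : ℝ := 4 * max 0 (sawtooth (u + 1 / 4) - 1 / 4)

/-- The displacement of the bone point `x` in a homotopy with parameter `τ ∈ [0, 2]`. For `τ ≤ 1`,
points move along the bone until the first half of every interval of length `2⁻ⁿ` is collapsed
to its left end; for `τ ≥ 1` these halves run forth and back along the teeth of a row of
height `a`. -/
def rowExcursion (n : ℕ) (a τ x : ℝ) : ℝ × ℝ :=
  (((2 : ℝ) ^ n)⁻¹ * (halfTent (2 ^ n * x) * max 0 (τ - 1)) - min 1 τ * scaledSawtooth n x,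
    a * scaledSawtooth n (((2 : ℝ) ^ n)⁻¹ * (halfTent (2 ^ n * x) * max 0 (τ - 1))))

/-- Tent functions with pairwise disjoint supports, of height `2` and centred at `4⁻ᵏ`. -/
def rowSelector (k : ℕ) (s : ℝ) : ℝ := max 0 (2 - 4 * |4 ^ k * s - 1|)

end

theorem halfTent_nonneg (u : ℝ) : 0 ≤ halfTent u :=
  mul_nonneg (by norm_num) (le_max_left _ _)

theorem halfTent_le_one (u : ℝ) : halfTent u ≤ 1 := by
  have : max 0 (sawtooth (u + 1 / 4) - 1 / 4) ≤ 1 / 4 :=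
    max_le (by norm_num) (by linarith [sawtooth_le_half (u + 1 / 4)])
  rw [halfTent]
  linarith

theorem continuous_halfTent : Continuous halfTent :=
  continuous_const.mul (continuous_const.max
    ((continuous_sawtooth.comp (continuous_id.add continuous_const)).sub continuous_const))

theorem halfTent_int_add (i : ℤ) {f : ℝ} (h0 : 0 ≤ f) (h1 : f ≤ 1 / 4) :
    halfTent (i + f) = 4 * f := by
  rw [halfTent, sawtooth_of_mem_Icc_right i _ ⟨by linarith, by linarith⟩,
    max_eq_right (by linarith)]
  ring

theorem fract_of_halfTent_ne_zero {u : ℝ} (hu : halfTent u ≠ 0) :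
    0 < Int.fract u ∧ Int.fract u ≤ 1 / 2 := by
  have h0 := Int.fract_nonneg u
  have h1 := Int.fract_lt_one u
  have h2 := Int.floor_add_fract u
  by_contra h
  apply hu
  have : sawtooth (u + 1 / 4) ≤ 1 / 4 := by
    rcases h0.eq_or_lt with h0 | h0
    · refine (sawtooth_le_abs_sub _ ⌊u⌋).trans (le_of_eq ?_)
      rw [show u + 1 / 4 - ⌊u⌋ = 1 / 4 by linarith]
      norm_num
    · have h3 : 1 / 2 < Int.fract u := by
        by_contra h4
        exact h ⟨h0, not_lt.1 h4⟩
      refine (sawtooth_le_abs_sub _ (⌊u⌋ + 1)).trans ?_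
      push_cast
      rw [abs_le]
      constructor <;> linarith
  rw [halfTent, max_eq_left (by linarith), mul_zero]

theorem continuous_rowExcursion (n : ℕ) (a : ℝ) :
    Continuous fun p : ℝ × ℝ => rowExcursion n a p.1 p.2 := by
  have h1 : Continuous fun p : ℝ × ℝ =>
      ((2 : ℝ) ^ n)⁻¹ * (halfTent (2 ^ n * p.2) * max 0 (p.1 - 1)) :=
    continuous_const.mul ((continuous_halfTent.comp (continuous_const.mul continuous_snd)).mul
      (continuous_const.max (continuous_fst.sub continuous_const)))
  exact (h1.sub ((continuous_const.min continuous_fst).mul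
    ((continuous_scaledSawtooth n).comp continuous_snd))).prodMk
      (continuous_const.mul ((continuous_scaledSawtooth n).comp h1))

theorem rowExcursion_zero (n : ℕ) (a x : ℝ) : rowExcursion n a 0 x = 0 := by
  simp [rowExcursion, scaledSawtooth, sawtooth_zero]

theorem scaledSawtooth_le (n : ℕ) (x : ℝ) : scaledSawtooth n x ≤ ((2 : ℝ) ^ n)⁻¹ := by
  refine mul_le_of_le_one_right (by positivity) ((sawtooth_le_half _).trans (by norm_num))

/-- The bound depends on the exponent alone, so it tends to zero along the rows and makes the sum of
all excursions continuous. -/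
theorem norm_rowExcursion_le (n : ℕ) {a τ : ℝ} (ha : |a| ≤ 1) (h0 : 0 ≤ τ) (h2 : τ ≤ 2) (x : ℝ) :
    ‖rowExcursion n a τ x‖ ≤ ((2 : ℝ) ^ n)⁻¹ := by
  have hp : (0 : ℝ) < ((2 : ℝ) ^ n)⁻¹ := by positivity
  refine max_le ?_ ?_
  · have hτ0 : 0 ≤ max 0 (τ - 1) := le_max_left _ _
    have hτ1 : max 0 (τ - 1) ≤ 1 := max_le (by norm_num) (by linarith)
    have h3 := mul_le_one₀ (halfTent_le_one (2 ^ n * x)) hτ0 hτ1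
    have h4 := mul_nonneg (halfTent_nonneg (2 ^ n * x)) hτ0
    have h5 := mul_le_of_le_one_right hp.le h3
    have h6 := mul_nonneg hp.le h4
    have h7 : 0 ≤ min 1 τ := le_min zero_le_one h0
    have h8 := mul_le_of_le_one_left (scaledSawtooth_nonneg n x) (min_le_left 1 τ)
    have h9 := mul_nonneg h7 (scaledSawtooth_nonneg n x)
    have h10 := scaledSawtooth_le n x
    rw [rowExcursion, Real.norm_eq_abs, abs_le]
    constructor <;> dsimp only <;> linarith
  · rw [rowExcursion, Real.norm_eq_abs, abs_mul, abs_of_nonneg (scaledSawtooth_nonneg n _)]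
    exact (mul_le_of_le_one_left (scaledSawtooth_nonneg n _) ha).trans (scaledSawtooth_le n _)

theorem add_rowExcursion_mem (n : ℕ) (a : ℝ) {τ x : ℝ} (h0 : 0 ≤ τ) (h2 : τ ≤ 2)
    (hx : x ∈ Set.Icc (0 : ℝ) 1) :
    (x, (0 : ℝ)) + rowExcursion n a τ x ∈
      sharkBone ∪ (fun t : ℝ => (t, a * scaledSawtooth n t)) '' Set.Icc 0 1 := by
  have hp : (0 : ℝ) < 2 ^ n := by positivity
  obtain ⟨hx0, hx1⟩ := hx
  have hu1 : (2 : ℝ) ^ n * x ≤ 2 ^ n := by nlinarith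
  -- With a zero excursion the point only slides left along the bone, by at most φ_n(x) ≤ x.
  by_cases hw : halfTent (2 ^ n * x) * max 0 (τ - 1) = 0
  · left
    have h7 : 0 ≤ min 1 τ := le_min zero_le_one h0
    have h8 := mul_le_of_le_one_left (scaledSawtooth_nonneg n x) (min_le_left 1 τ)
    have h9 := mul_nonneg h7 (scaledSawtooth_nonneg n x)
    have h10 := scaledSawtooth_le_self n hx0
    simp only [rowExcursion, hw, sharkBone, Set.mem_prod, Set.mem_Icc, Set.mem_singleton_iff,
      Prod.fst_add, Prod.snd_add]
    refine ⟨⟨by linarith, by linarith⟩, ?_⟩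
    simp [scaledSawtooth, sawtooth_zero]
  · right
    obtain ⟨ht, hτ⟩ := mul_ne_zero_iff.1 hw
    have hτ1 : 1 < τ := by
      by_contra h
      exact hτ (max_eq_left (by linarith))
    obtain ⟨hf0, hf1⟩ := fract_of_halfTent_ne_zero ht
    set u := (2 : ℝ) ^ n * x with hu
    have hfl := Int.floor_add_fract u
    have hsaw : sawtooth u = u - ⌊u⌋ :=
      sawtooth_of_mem_Icc_right _ _ ⟨by linarith, by linarith⟩
    -- Here x is in the first half of its dyadic interval, hence already collapsed to the left end.
    -- The excursion starts at a zero of φ_n and therefore follows the row.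
    have hxs : x - scaledSawtooth n x = ⌊u⌋ / 2 ^ n := by
      rw [scaledSawtooth, ← hu, hsaw, eq_div_iff hp.ne', sub_mul, mul_right_comm,
        inv_mul_cancel₀ hp.ne']
      linarith
    have hm1 : max 0 (τ - 1) ≤ 1 := max_le (by norm_num) (by linarith)
    have hw1 := mul_le_one₀ (halfTent_le_one u) (le_max_left _ _) hm1
    have hw0 := mul_nonneg (halfTent_nonneg u) (le_max_left 0 (τ - 1))
    have hf : ⌊u⌋ + 1 ≤ (2 : ℤ) ^ n := by
      have : (⌊u⌋ : ℝ) < ((2 ^ n : ℤ) : ℝ) := by push_cast; linarith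
      exact Int.add_one_le_iff.2 (by exact_mod_cast this)
    have hf' : (⌊u⌋ : ℝ) + 1 ≤ 2 ^ n := by exact_mod_cast hf
    have hf2 : (0 : ℝ) ≤ ⌊u⌋ := Int.cast_nonneg (Int.floor_nonneg.2 (mul_nonneg hp.le hx0))
    refine ⟨⌊u⌋ / 2 ^ n + ((2 : ℝ) ^ n)⁻¹ * (halfTent u * max 0 (τ - 1)), ⟨by positivity, ?_⟩, ?_⟩
    · rw [div_eq_inv_mul, ← mul_add, inv_mul_le_iff₀ hp]
      linarith
    · dsimp only
      rw [scaledSawtooth_div_add, rowExcursion, ← hu, min_eq_left hτ1.le, ← hxs]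
      ext <;> simp only [Prod.fst_add, Prod.snd_add] <;> ring

/-- At τ = 2 the first quarter of each interval of length 2⁻ⁿ is stretched fourfold over the whole
tooth, so dividing the fractional part of 2ⁿt by 4 gives the preimage. -/
theorem exists_add_rowExcursion_eq (n : ℕ) (a : ℝ) {t : ℝ} (ht : t ∈ Set.Icc (0 : ℝ) 1) :
    ∃ x ∈ Set.Icc (0 : ℝ) 1,
      (x, (0 : ℝ)) + rowExcursion n a 2 x = (t, a * scaledSawtooth n t) := by
  have hp : (0 : ℝ) < 2 ^ n := by positivity
  set v := (2 : ℝ) ^ n * t with hv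
  have h0 := Int.fract_nonneg v
  have h1 := Int.fract_lt_one v
  have h2 := Int.floor_add_fract v
  have h3 : (0 : ℝ) ≤ ⌊v⌋ := Int.cast_nonneg (Int.floor_nonneg.2 (mul_nonneg hp.le ht.1))
  have hvt : t = ((2 : ℝ) ^ n)⁻¹ * v := by rw [hv, inv_mul_cancel_left₀ hp.ne']
  have hx : (2 : ℝ) ^ n * (((2 : ℝ) ^ n)⁻¹ * (⌊v⌋ + Int.fract v / 4)) =
      ⌊v⌋ + Int.fract v / 4 := mul_inv_cancel_left₀ hp.ne' _
  have hs : scaledSawtooth n (((2 : ℝ) ^ n)⁻¹ * (⌊v⌋ + Int.fract v / 4)) =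
      ((2 : ℝ) ^ n)⁻¹ * (Int.fract v / 4) := by
    rw [scaledSawtooth, hx, sawtooth_of_mem_Icc_right ⌊v⌋ _ ⟨by linarith, by linarith⟩]
    ring
  have hw : ((2 : ℝ) ^ n)⁻¹ * (halfTent (⌊v⌋ + Int.fract v / 4) * max 0 (2 - 1)) =
      ((2 : ℝ) ^ n)⁻¹ * Int.fract v := by
    rw [halfTent_int_add _ (by linarith) (by linarith), max_eq_right (by norm_num)]
    ring
  have ht' : t = ⌊v⌋ / 2 ^ n + ((2 : ℝ) ^ n)⁻¹ * Int.fract v := by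
    rw [div_eq_inv_mul, ← mul_add, h2, hvt]
  refine ⟨((2 : ℝ) ^ n)⁻¹ * (⌊v⌋ + Int.fract v / 4), ⟨by positivity, ?_⟩, ?_⟩
  · refine le_trans ?_ ht.2
    rw [hvt]
    exact mul_le_mul_of_nonneg_left (by linarith) (by positivity)
  · have hst : scaledSawtooth n t = scaledSawtooth n (((2 : ℝ) ^ n)⁻¹ * Int.fract v) :=
      (congrArg _ ht').trans (scaledSawtooth_div_add _ _ _)
    rw [rowExcursion, hx, hw, hs, hst, min_eq_left (by norm_num)]
    ext
    · simp only [Prod.fst_add]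
      refine Eq.trans ?_ ht'.symm
      ring
    · simp only [Prod.snd_add, zero_add]

theorem rowSelector_nonneg (k : ℕ) (s : ℝ) : 0 ≤ rowSelector k s := le_max_left _ _

theorem rowSelector_le_two (k : ℕ) (s : ℝ) : rowSelector k s ≤ 2 :=
  max_le (by norm_num) (by linarith [abs_nonneg ((4 : ℝ) ^ k * s - 1)])

theorem rowSelector_zero (k : ℕ) : rowSelector k 0 = 0 := by
  norm_num [rowSelector]

theorem rowSelector_inv_pow (k : ℕ) : rowSelector k ((4 : ℝ) ^ k)⁻¹ = 2 := by
  rw [rowSelector, mul_inv_cancel₀ (by positivity)]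
  norm_num

theorem continuous_rowSelector (k : ℕ) : Continuous (rowSelector k) := by
  unfold rowSelector
  fun_prop

theorem rowSelector_disjoint {s : ℝ} {j k : ℕ} (hj : rowSelector j s ≠ 0)
    (hk : rowSelector k s ≠ 0) : j = k := by
  -- The window (1/2, 3/2) has end ratio 3, less than the factor 4 between consecutive scales.
  have key : ∀ i : ℕ, rowSelector i s ≠ 0 → 1 / 2 < 4 ^ i * s ∧ 4 ^ i * s < 3 / 2 := by
    intro i hi
    have : 0 < 2 - 4 * |4 ^ i * s - 1| := by
      by_contra h
      exact hi (max_eq_left (not_lt.1 h))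
    have h2 : |4 ^ i * s - 1| < 1 / 2 := by linarith
    obtain ⟨h3, h4⟩ := abs_lt.1 h2
    exact ⟨by linarith, by linarith⟩
  have lt_false : ∀ i l : ℕ, rowSelector i s ≠ 0 → rowSelector l s ≠ 0 → ¬ i < l := by
    intro i l hi hl hil
    obtain ⟨h1, h2⟩ := key i hi
    obtain ⟨h3, h4⟩ := key l hl
    obtain ⟨d, rfl⟩ := Nat.exists_eq_add_of_lt hil
    have h5 : (1 : ℝ) ≤ 4 ^ d := one_le_pow₀ (by norm_num)
    have h6 : (4 : ℝ) ^ (i + d + 1) * s = 4 * 4 ^ d * (4 ^ i * s) := by ring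
    nlinarith
  exact le_antisymm (not_lt.1 (lt_false k j hk hj)) (not_lt.1 (lt_false j k hj hk))

/-- The bone together with the rows with numbers `≥ k₀` is a continuous image of the interval. -/
theorem exists_path_onto_teeth {n : ℕ → ℕ} (hn : Filter.Tendsto n Filter.atTop Filter.atTop)
    {k₀ : ℕ} (hk₀ : 1 ≤ k₀) :
    ∃ p : unitInterval → ℝ × ℝ, Continuous p ∧
      Set.range p = sharkBone ∪ ⋃ k ∈ Set.Ici k₀, sharkRow n k := by
  obtain ⟨q, hq, hqs⟩ := exists_continuous_surjective_unitInterval_prod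
  let G : ℕ → unitInterval × unitInterval → ℝ × ℝ := fun j z =>
    rowExcursion (n (k₀ + j)) (1 / ((k₀ + j : ℕ) : ℝ)) (rowSelector j z.1) z.2
  have hGc : ∀ j, Continuous (G j) := fun j =>
    (continuous_rowExcursion _ _).comp (f := fun z : unitInterval × unitInterval =>
      (rowSelector j z.1, (z.2 : ℝ))) (((continuous_rowSelector j).comp
        (continuous_subtype_val.comp continuous_fst)).prodMk
          (continuous_subtype_val.comp continuous_snd))
  have hGb : ∀ j z, ‖G j z‖ ≤ ((2 : ℝ) ^ n (k₀ + j))⁻¹ := fun j z => by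
    refine norm_rowExcursion_le _ ?_ (rowSelector_nonneg _ _) (rowSelector_le_two _ _) _
    have : (1 : ℝ) ≤ ((k₀ + j : ℕ) : ℝ) := by exact_mod_cast hk₀.trans (Nat.le_add_right _ _)
    rw [abs_of_nonneg (by positivity), div_le_one (by positivity)]
    exact this
  have hb : Filter.Tendsto (fun j => ((2 : ℝ) ^ n (k₀ + j))⁻¹) Filter.atTop (nhds 0) := by
    refine tendsto_inv_atTop_zero.comp
      ((tendsto_pow_atTop_atTop_of_one_lt one_lt_two).comp (hn.comp ?_))
    exact Filter.tendsto_atTop_mono (fun j => Nat.le_add_left j k₀) Filter.tendsto_id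
  have hG0 : ∀ j z, rowSelector j (z : unitInterval × unitInterval).1 = 0 → G j z = 0 :=
    fun j z h => by simp only [G, h, rowExcursion_zero]
  have hd : ∀ z j k, G j z ≠ 0 → G k z ≠ 0 → j = k := fun z j k hj hk =>
    rowSelector_disjoint (fun h => hj (hG0 j z h)) fun h => hk (hG0 k z h)
  let F : unitInterval × unitInterval → ℝ × ℝ := fun z => ((z.2 : ℝ), (0 : ℝ)) + ∑' j, G j z
  have hF : Continuous F :=
    ((continuous_subtype_val.comp continuous_snd).prodMk continuous_const).add
      (continuous_tsum_of_disjoint_support hGc hb hGb hd)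
  have hFj : ∀ j z, rowSelector j (z : unitInterval × unitInterval).1 ≠ 0 →
      F z = ((z.2 : ℝ), (0 : ℝ)) + G j z := fun j z h => by
    simp only [F]
    rw [tsum_eq_single j fun i hi => hG0 i z ?_]
    by_contra h'
    exact hi (rowSelector_disjoint h' h)
  refine ⟨F ∘ q, hF.comp hq, ?_⟩
  rw [hqs.range_comp]
  refine Set.Subset.antisymm ?_ ?_
  · rintro _ ⟨z, rfl⟩
    by_cases hz : ∃ j, rowSelector j z.1 ≠ 0
    · obtain ⟨j, hj⟩ := hz
      rw [hFj j z hj]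
      refine (add_rowExcursion_mem (n (k₀ + j)) (1 / ((k₀ + j : ℕ) : ℝ)) (rowSelector_nonneg j z.1)
        (rowSelector_le_two j z.1) z.2.2).imp id fun h => ?_
      exact Set.mem_biUnion (x := k₀ + j) (Nat.le_add_right _ _) h
    · push Not at hz
      have : F z = ((z.2 : ℝ), (0 : ℝ)) := by
        simp only [F, fun j => hG0 j z (hz j), tsum_zero, add_zero]
      rw [this]
      exact Or.inl ⟨z.2.2, rfl⟩
  · rintro ⟨x, y⟩ (h | h)
    · obtain ⟨hx, hy⟩ := h
      -- All selectors vanish at s = 0, which leaves the bone in place.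
      refine ⟨(0, ⟨x, hx⟩), ?_⟩
      have : ∀ j, G j (0, ⟨x, hx⟩) = 0 := fun j => hG0 j _ (rowSelector_zero j)
      simp only [F, this, tsum_zero, add_zero]
      exact Prod.ext rfl (Eq.symm hy)
    · obtain ⟨k, hk, t, ht, hty⟩ := Set.mem_iUnion₂.1 h
      obtain ⟨j, rfl⟩ := Nat.exists_eq_add_of_le (Set.mem_Ici.1 hk)
      obtain ⟨x', hx', h'⟩ :=
        exists_add_rowExcursion_eq (n (k₀ + j)) (1 / ((k₀ + j : ℕ) : ℝ)) ht
      have hs : ((4 : ℝ) ^ j)⁻¹ ∈ unitInterval :=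
        ⟨by positivity, inv_le_one_of_one_le₀ (one_le_pow₀ (by norm_num))⟩
      refine ⟨(⟨_, hs⟩, ⟨x', hx'⟩), ?_⟩
      rw [hFj j _ (by simp only [rowSelector_inv_pow]; norm_num)]
      simp only [G, rowSelector_inv_pow]
      rw [h', ← hty]

/-! ### The topological fractal structure. -/

/-- A compact metric space is a topological fractal if it has a continuous map `r` onto the interval
and a finite cover by images of paths along which `r` is `1/2`-Lipschitz. -/
theorem isTopologicalFractal_of_paths {X : Type*} [MetricSpace X] [CompactSpace X] {ι : Type*}
    [Finite ι] {r : X → unitInterval} (hr : Continuous r) (hrs : Function.Surjective r)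
    {h : ι → unitInterval → X} (hh : ∀ i, Continuous (h i))
    (hL : ∀ i s t, dist (r (h i s)) (r (h i t)) ≤ 1 / 2 * dist s t)
    (hcov : ∀ x, ∃ i s, h i s = x) : IsTopologicalFractal X := by
  refine ⟨inferInstance, Set.range fun i => h i ∘ r, Set.finite_range _, ?_, ?_, ?_⟩
  · rintro _ ⟨i, rfl⟩
    exact (hh i).comp hr
  · refine Set.eq_univ_of_forall (fun x => ?_) |>.symm
    obtain ⟨i, s, rfl⟩ := hcov x
    obtain ⟨y, rfl⟩ := hrs s
    exact Set.mem_biUnion ⟨i, rfl⟩ ⟨y, rfl⟩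
  · intro 𝒰 h𝒰 hU
    have hword : ∀ l : List (X → X), (∀ f ∈ l, f ∈ Set.range fun i => h i ∘ r) → ∀ x y,
        dist (r (l.foldr (fun f g => f ∘ g) id x)) (r (l.foldr (fun f g => f ∘ g) id y)) ≤
          (1 / 2) ^ l.length := by
      intro l
      induction l with
      | nil =>
        intro _ x y
        rw [List.length_nil, pow_zero]
        exact Real.dist_le_of_mem_Icc_01 (r x).2 (r y).2
      | cons f l ih =>
        intro hl x y
        obtain ⟨i, rfl⟩ := hl f List.mem_cons_self
        have := ih (fun g hg => hl g (List.mem_cons_of_mem _ hg)) x y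
        refine (hL i _ _).trans ?_
        rw [List.length_cons, pow_succ']
        exact mul_le_mul_of_nonneg_left this (by norm_num)
    obtain ⟨δ, hδ, hball⟩ :=
      lebesgue_number_lemma_of_metric_sUnion (isCompact_univ (X := X)) h𝒰 hU.ge
    have huc : ∀ i, ∃ ε > 0, ∀ s t, dist s t < ε → dist (h i s) (h i t) < δ := fun i => by
      obtain ⟨ε, hε, H⟩ := Metric.uniformContinuous_iff.1
        (CompactSpace.uniformContinuous_of_continuous (hh i)) δ hδ
      exact ⟨ε, hε, fun s t => @H s t⟩
    choose ε hε hεh using huc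
    obtain ⟨x₀, -⟩ := hrs 0
    obtain ⟨i₀, -⟩ := hcov x₀
    obtain ⟨i₁, hi₁⟩ := @Finite.exists_min ι ℝ _ ⟨i₀⟩ _ ε
    obtain ⟨n, hn⟩ := exists_pow_lt_of_lt_one (hε i₁) (show (1 / 2 : ℝ) < 1 by norm_num)
    -- The inner n letters shrink the r-image to diameter at most 2⁻ⁿ; the outermost letter only
    -- needs uniform continuity of its path.
    refine ⟨n + 1, fun l hl hlF => ?_⟩
    obtain ⟨f, l, rfl⟩ := List.exists_cons_of_length_eq_add_one hl
    obtain ⟨i, rfl⟩ := hlF f List.mem_cons_self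
    have hw := hword l fun g hg => hlF g (List.mem_cons_of_mem _ hg)
    rw [Nat.add_right_cancel hl] at hw
    obtain ⟨U, hU, hbU⟩ := hball (List.foldr (fun f g => f ∘ g) id ((h i ∘ r) :: l) x₀) trivial
    refine ⟨U, hU, ?_⟩
    rintro _ ⟨x, rfl⟩
    exact hbU (hεh i _ _ ((hw x x₀).trans_lt (hn.trans_le (hi₁ i))))

theorem mem_sharkTeeth_row {n : ℕ → ℕ} {k : ℕ} (hk : 1 ≤ k) {t : ℝ}
    (ht : t ∈ Set.Icc (0 : ℝ) 1) :
    (t, 1 / (k : ℝ) * scaledSawtooth (n k) t) ∈ sharkTeeth n :=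
  Or.inr (Set.mem_biUnion (Set.mem_Ici.2 hk) ⟨t, ht, rfl⟩)

theorem mem_sharkTeeth_bone {n : ℕ → ℕ} {t : ℝ} (ht : t ∈ Set.Icc (0 : ℝ) 1) :
    (t, (0 : ℝ)) ∈ sharkTeeth n :=
  Or.inl ⟨ht, rfl⟩

theorem exists_path_onto_sharkTeeth {n : ℕ → ℕ}
    (hn : Filter.Tendsto n Filter.atTop Filter.atTop) :
    ∃ p : unitInterval → sharkTeeth n, Continuous p ∧ Function.Surjective p := by
  obtain ⟨p, hp, hpr⟩ := exists_path_onto_teeth hn le_rfl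
  refine ⟨fun t => ⟨p t, hpr.subset ⟨t, rfl⟩⟩, hp.subtype_mk _, fun z => ?_⟩
  obtain ⟨t, ht⟩ := hpr.superset z.2
  exact ⟨t, Subtype.ext ht⟩

theorem isTopologicalFractal_sharkTeeth {n : ℕ → ℕ}
    (hn : Filter.Tendsto n Filter.atTop Filter.atTop) (hn1 : n 1 = 0) :
    IsTopologicalFractal (sharkTeeth n) := by
  have hcomp : CompactSpace (sharkTeeth n) := by
    obtain ⟨p, hp, hps⟩ := exists_path_onto_sharkTeeth hn
    exact hps.compactSpace hp
  obtain ⟨p, hp, hpr⟩ := exists_path_onto_teeth hn one_le_two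
  have hpmem : ∀ s, p s ∈ sharkTeeth n := fun s => by
    refine (hpr.subset ⟨s, rfl⟩).imp id fun h => ?_
    obtain ⟨k, hk, h⟩ := Set.mem_iUnion₂.1 h
    exact Set.mem_biUnion (one_le_two.trans (Set.mem_Ici.1 hk)) h
  -- On the first row this is 2φ. On the bone and the rows k ≥ 2 the height is at most φ/2, so the
  -- projection truncates to 0.
  let r : ℝ × ℝ → unitInterval := fun z => Set.projIcc 0 1 zero_le_one (2 * (2 * z.2 - sawtooth z.1))
  have hr : Continuous r := continuous_projIcc.comp (continuous_const.mul
    ((continuous_const.mul continuous_snd).sub (continuous_sawtooth.comp continuous_fst)))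
  have hrow : ∀ t, r (t, sawtooth t) = Set.projIcc 0 1 zero_le_one (2 * sawtooth t) := fun t => by
    simp only [r]
    congr 1
    ring
  have hrp : ∀ s, r (p s) = 0 := fun s => by
    refine Set.projIcc_of_le_left _ ?_
    rcases hpr.subset ⟨s, rfl⟩ with h | h
    · have h2 : (p s).2 = 0 := h.2
      linarith [sawtooth_nonneg (p s).1]
    · obtain ⟨k, hk, t, ht, hkt⟩ := Set.mem_iUnion₂.1 h
      rw [← hkt]
      have h1 : scaledSawtooth (n k) t ≤ sawtooth t := by
        rw [← scaledSawtooth_zero]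
        exact scaledSawtooth_antitone t (Nat.zero_le _)
      have h2 : 1 / (k : ℝ) ≤ 1 / 2 :=
        one_div_le_one_div_of_le (by norm_num) (by exact_mod_cast Set.mem_Ici.1 hk)
      have h3 := mul_le_mul h2 h1 (scaledSawtooth_nonneg _ _) (by norm_num)
      dsimp only
      linarith
  have hrowmem : ∀ t ∈ Set.Icc (0 : ℝ) 1, (t, sawtooth t) ∈ sharkTeeth n := fun t ht => by
    have := mem_sharkTeeth_row (n := n) le_rfl ht
    rwa [hn1, scaledSawtooth_zero, Nat.cast_one, div_one, one_mul] at this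
  have hquarter : ∀ (i : Fin 4) (s : unitInterval), ((i : ℝ) + s) / 4 ∈ Set.Icc (0 : ℝ) 1 := by
    intro i s
    have h1 : (i : ℝ) ≤ 3 := by exact_mod_cast Nat.le_of_lt_succ i.2
    have h2 := s.2.1
    have h3 := s.2.2
    constructor
    · positivity
    · linarith
  -- Slope 2 of 2φ times speed 1/4 of a quarter gives the required constant 1/2.
  let h : Option (Fin 4) → unitInterval → sharkTeeth n := fun o s =>
    o.elim ⟨p s, hpmem s⟩ fun i => ⟨_, hrowmem _ (hquarter i s)⟩
  refine isTopologicalFractal_of_paths (r := fun z => r z) (h := h)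
    (hr.comp continuous_subtype_val) ?_ ?_ ?_ ?_
  · intro s
    have hs : (s : ℝ) / 2 ∈ Set.Icc (0 : ℝ) 1 := ⟨by linarith [s.2.1], by linarith [s.2.2]⟩
    refine ⟨⟨_, hrowmem _ hs⟩, ?_⟩
    dsimp only
    rw [hrow, sawtooth_of_mem_Icc_right 0 _ (by
      push_cast
      exact ⟨by linarith [s.2.1], by linarith [s.2.2]⟩)]
    rw [Int.cast_zero, sub_zero, mul_div_cancel₀ _ two_ne_zero, Set.projIcc_val]
  · rintro (_ | i)
    · exact hp.subtype_mk _
    · refine Continuous.subtype_mk ?_ _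
      have hc : Continuous fun s : unitInterval => ((i : ℝ) + s) / 4 :=
        (continuous_const.add continuous_subtype_val).div_const _
      exact hc.prodMk (continuous_sawtooth.comp hc)
  · rintro (_ | i) s t
    · simp only [h, Option.elim, hrp, dist_self]
      positivity
    · simp only [h, Option.elim, hrow]
      have h1 : dist (Set.projIcc (0 : ℝ) 1 zero_le_one (2 * sawtooth (((i : ℝ) + s) / 4)))
          (Set.projIcc (0 : ℝ) 1 zero_le_one (2 * sawtooth (((i : ℝ) + t) / 4))) ≤
          |2 * sawtooth (((i : ℝ) + s) / 4) - 2 * sawtooth (((i : ℝ) + t) / 4)| :=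
        Set.abs_projIcc_sub_projIcc _
      refine h1.trans ?_
      have h2 := abs_sawtooth_sub_le (((i : ℝ) + s) / 4) (((i : ℝ) + t) / 4)
      rw [show ((i : ℝ) + s) / 4 - ((i : ℝ) + t) / 4 = 1 / 4 * (s - t) by ring, abs_mul,
        abs_of_pos (show (0 : ℝ) < 1 / 4 by norm_num)] at h2
      rw [← mul_sub, abs_mul, abs_two, Subtype.dist_eq, Real.dist_eq]
      linarith
  · rintro ⟨z, hz⟩
    have hz' : (∃ t ∈ Set.Icc (0 : ℝ) 1, (t, sawtooth t) = z) ∨ z ∈ Set.range p := by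
      rcases hz with hz | hz
      · exact Or.inr (hpr.superset (Or.inl hz))
      · obtain ⟨k, hk, hkz⟩ := Set.mem_iUnion₂.1 hz
        rcases (Set.mem_Ici.1 hk).eq_or_lt with rfl | hk
        · obtain ⟨t, ht, rfl⟩ := hkz
          refine Or.inl ⟨t, ht, ?_⟩
          dsimp only
          rw [hn1, scaledSawtooth_zero, Nat.cast_one, div_one, one_mul]
        · exact Or.inr (hpr.superset (Or.inr (Set.mem_biUnion (Set.mem_Ici.2 hk) hkz)))
    rcases hz' with ⟨t, ht, rfl⟩ | ⟨s, rfl⟩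
    · obtain ⟨i, hi⟩ : ∃ i : Fin 4, (i : ℝ) ≤ 4 * t ∧ 4 * t ≤ i + 1 := by
        by_cases h1 : 4 * t ≤ 1
        · exact ⟨0, by simpa using ht.1, by simpa using h1⟩
        by_cases h2 : 4 * t ≤ 2
        · exact ⟨1, by norm_num; linarith, by norm_num; linarith⟩
        by_cases h3 : 4 * t ≤ 3
        · exact ⟨2, by norm_num; linarith, by norm_num; linarith⟩
        · exact ⟨3, by norm_num; linarith, by norm_num; linarith [ht.2]⟩
      refine ⟨some i, ⟨4 * t - i, by linarith, by linarith⟩, Subtype.ext ?_⟩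
      have : ((i : ℝ) + (4 * t - i)) / 4 = t := by ring
      simp only [h, Option.elim, this]
    · exact ⟨none, s, rfl⟩

/-! ### Counting the rows of a given exponent. -/

theorem le_sharkExponent_iff {n k : ℕ} (hk : 1 ≤ k) : n ≤ sharkExponent k ↔ 2 ^ 2 ^ n ≤ k + 1 := by
  have hk' : (1 : ℝ) < (k : ℝ) + 1 := by
    have : (1 : ℝ) ≤ k := by exact_mod_cast hk
    linarith
  have h0 : 1 ≤ Real.logb 2 ((k : ℝ) + 1) := by
    rw [Real.le_logb_iff_rpow_le one_lt_two (by linarith), Real.rpow_one]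
    have : (1 : ℝ) ≤ k := by exact_mod_cast hk
    linarith
  rw [sharkExponent, Nat.le_floor_iff (Real.logb_nonneg one_lt_two h0),
    Real.le_logb_iff_rpow_le one_lt_two (by linarith),
    Real.le_logb_iff_rpow_le one_lt_two (by linarith), Real.rpow_natCast]
  have h1 : (2 : ℝ) ^ ((2 : ℝ) ^ n) = ((2 ^ 2 ^ n : ℕ) : ℝ) := by
    rw [show ((2 : ℝ) ^ n) = ((2 ^ n : ℕ) : ℝ) by push_cast; rfl, Real.rpow_natCast]
    push_cast
    rfl
  rw [h1]
  exact_mod_cast Iff.rfl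

theorem sharkExponent_one : sharkExponent 1 = 0 := by
  norm_num [sharkExponent]

theorem sharkExponent_le {j k : ℕ} (hj : 1 ≤ j) (hjk : j ≤ k) :
    sharkExponent j ≤ sharkExponent k :=
  (le_sharkExponent_iff (hj.trans hjk)).2
    (((le_sharkExponent_iff hj).1 le_rfl).trans (by omega))

theorem tendsto_sharkExponent : Filter.Tendsto sharkExponent Filter.atTop Filter.atTop := by
  refine Filter.tendsto_atTop_atTop.2 fun n => ⟨2 ^ 2 ^ n, fun k hk => ?_⟩
  exact (le_sharkExponent_iff (Nat.one_le_two_pow.trans hk)).2 (hk.trans (Nat.le_succ k))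

theorem sharkExponent_two_pow_add {n j : ℕ} (hn : 1 ≤ n) (hj : j < 2 ^ 2 ^ n) :
    sharkExponent (2 ^ 2 ^ n + j) = n := by
  have h1 : 1 ≤ 2 ^ 2 ^ n + j := Nat.one_le_two_pow.trans (Nat.le_add_right _ _)
  refine le_antisymm ?_ ((le_sharkExponent_iff h1).2 (by omega))
  by_contra h
  have h2 := (le_sharkExponent_iff h1).1 (Nat.succ_le_of_lt (not_le.1 h))
  -- With P = 2^(2^n) ≥ 4, P² exceeds P + j + 1 ≤ 2P. For n = 0 this breaks down: k = 3 already has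
  -- exponent 1.
  have h3 : 4 ≤ 2 ^ 2 ^ n := by
    calc 4 = 2 ^ 2 ^ 1 := by norm_num
      _ ≤ 2 ^ 2 ^ n := Nat.pow_le_pow_right two_pos (Nat.pow_le_pow_right two_pos hn)
  have h4 : 2 ^ 2 ^ (n + 1) = 2 ^ 2 ^ n * 2 ^ 2 ^ n := by
    rw [← pow_add, pow_succ]
    congr 1
    ring
  rw [Nat.succ_eq_add_one, h4] at h2
  nlinarith

/-! ### Separation of rows and connected covers. -/

/-- A preconnected subset of the shark teeth that meets two rows over the same interval of length
`2⁻ᴺ` has to contain an end of this interval. -/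
theorem not_isPreconnected_of_mem_rows {n : ℕ → ℕ} (hn : ∀ j k, 1 ≤ j → j ≤ k → n j ≤ n k)
    {N k k' : ℕ} {i : ℤ} (hk : 1 ≤ k) (hkk' : k < k') (hnk : n k = N) {S : Set (ℝ × ℝ)}
    (hSM : S ⊆ sharkTeeth n) (ha : ((i : ℝ) / 2 ^ N, (0 : ℝ)) ∉ S)
    (hb : (((i : ℝ) + 1) / 2 ^ N, (0 : ℝ)) ∉ S) {t t' : ℝ}
    (ht : t ∈ Set.Ioo ((i : ℝ) / 2 ^ N) ((i + 1) / 2 ^ N))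
    (ht' : t' ∈ Set.Ioo ((i : ℝ) / 2 ^ N) ((i + 1) / 2 ^ N))
    (hmem : (t, 1 / (k : ℝ) * scaledSawtooth N t) ∈ S)
    (hmem' : (t', 1 / (k' : ℝ) * scaledSawtooth N t') ∈ S) : ¬ IsPreconnected S := by
  intro hS
  set a : ℝ := (i : ℝ) / 2 ^ N with ha_def
  set b : ℝ := ((i : ℝ) + 1) / 2 ^ N with hb_def
  have hk0 : (0 : ℝ) < k := by exact_mod_cast hk
  -- Since 1/(k+1) < θ < 1/k, the graph of θφ_N over (a, b) passes between row k and all later rows;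
  -- W is the region below it, strictly between the ends.
  set θ : ℝ := 1 / ((k : ℝ) + 1 / 2) with hθ
  have hθ0 : 0 < θ := by positivity
  have hθk : ∀ j : ℕ, 1 ≤ j → j ≤ k → θ < 1 / (j : ℝ) := fun j hj hjk => by
    have h1 : (1 : ℝ) ≤ j := by exact_mod_cast hj
    have h2 : (j : ℝ) ≤ k := by exact_mod_cast hjk
    exact one_div_lt_one_div_of_lt (by linarith) (by linarith)
  have hθk' : ∀ j : ℕ, k < j → 1 / (j : ℝ) < θ := fun j hj => by
    have h1 : (k : ℝ) + 1 ≤ j := by exact_mod_cast hj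
    exact one_div_lt_one_div_of_lt (by linarith) (by linarith)
  have hcont : Continuous fun z : ℝ × ℝ => θ * scaledSawtooth N z.1 :=
    continuous_const.mul ((continuous_scaledSawtooth N).comp continuous_fst)
  let W : Set (ℝ × ℝ) := {z | a < z.1} ∩ {z | z.1 < b} ∩ {z | z.2 < θ * scaledSawtooth N z.1}
  let W' : Set (ℝ × ℝ) := {z | z.1 < a} ∪ {z | b < z.1} ∪ {z | θ * scaledSawtooth N z.1 < z.2}
  have hW : IsOpen W := ((isOpen_lt continuous_const continuous_fst).inter
    (isOpen_lt continuous_fst continuous_const)).inter (isOpen_lt continuous_snd hcont)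
  have hW' : IsOpen W' := ((isOpen_lt continuous_fst continuous_const).union
    (isOpen_lt continuous_const continuous_fst)).union (isOpen_lt hcont continuous_snd)
  have hsub : S ⊆ W ∪ W' := by
    rintro ⟨x, y⟩ hz
    have hy : 0 ≤ y := by
      rcases hSM hz with h | h
      · exact (show y = 0 from h.2).ge
      · obtain ⟨j, -, s, -, hs⟩ := Set.mem_iUnion₂.1 h
        obtain ⟨rfl, rfl⟩ := Prod.mk.inj hs
        exact mul_nonneg (by positivity) (scaledSawtooth_nonneg _ _)
    -- Over an end the graph has height 0, and its only point there is excluded from S.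
    have hend : ∀ l : ℤ, x = l / 2 ^ N → (x, (0 : ℝ)) ∉ S → (x, y) ∈ W' := by
      intro l hl h0
      refine Or.inr ?_
      change θ * scaledSawtooth N x < y
      refine lt_of_le_of_ne ?_ ?_
      · rwa [hl, scaledSawtooth_div, mul_zero]
      · simp only [hl, scaledSawtooth_div, mul_zero]
        rintro rfl
        exact h0 hz
    rcases lt_trichotomy x a with hxa | hxa | hxa
    · exact Or.inr (Or.inl (Or.inl hxa))
    · exact Or.inr (hend i hxa (hxa ▸ ha))
    rcases lt_trichotomy x b with hxb | hxb | hxb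
    · have hφ : 0 < scaledSawtooth N x := scaledSawtooth_pos ⟨hxa, hxb⟩
      rcases hSM hz with h | h
      · have : y = 0 := h.2
        subst this
        exact Or.inl ⟨⟨hxa, hxb⟩, mul_pos hθ0 hφ⟩
      · obtain ⟨j, hj, s, -, hs⟩ := Set.mem_iUnion₂.1 h
        obtain ⟨rfl, rfl⟩ := Prod.mk.inj hs
        rcases le_or_gt j k with hjk | hjk
        · refine Or.inr (Or.inr ?_)
          have h1 := scaledSawtooth_antitone s (hnk ▸ hn j k hj hjk)
          have h2 := hθk j hj hjk
          exact (mul_lt_mul_of_pos_right h2 hφ).trans_le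
            (mul_le_mul_of_nonneg_left h1 (by positivity))
        · refine Or.inl ⟨⟨hxa, hxb⟩, ?_⟩
          have h1 := scaledSawtooth_antitone s (hnk ▸ hn k j hk hjk.le)
          have h2 := hθk' j hjk
          exact (mul_le_mul_of_nonneg_left h1 (by positivity)).trans_lt
            (mul_lt_mul_of_pos_right h2 hφ)
    · exact Or.inr (hend (i + 1) (by rw [hxb, hb_def]; push_cast; rfl) (hxb ▸ hb))
    · exact Or.inr (Or.inl (Or.inr hxb))
  obtain ⟨z, -, ⟨⟨h1, h2⟩, h3⟩, h4⟩ := hS W W' hW hW' hsub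
    ⟨_, hmem', ⟨ht'.1, ht'.2⟩, mul_lt_mul_of_pos_right (hθk' k' hkk') (scaledSawtooth_pos ht')⟩
    ⟨_, hmem, Or.inr (mul_lt_mul_of_pos_right (hθk k hk le_rfl) (scaledSawtooth_pos ht))⟩
  rcases h4 with (h4 | h4) | h4
  · exact lt_asymm (show a < z.1 from h1) h4
  · exact lt_asymm (show z.1 < b from h2) h4
  · exact lt_asymm (show z.2 < θ * scaledSawtooth N z.1 from h3) h4

/-- A connected space which is the union of the images of `N` contractions with constant `c` is,
for every `m`, covered by `Nᵐ` connected sets of diameter at most `cᵐ D`. -/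
theorem exists_cover_of_contractions {X Y ι : Type*} [TopologicalSpace X] [PreconnectedSpace X]
    [PseudoMetricSpace Y] [Fintype ι] {g : X → Y} {f : ι → X → X} {c D : ℝ} (hc : 0 ≤ c)
    (hf : ∀ i, Continuous (f i))
    (hfc : ∀ i x y, dist (g (f i x)) (g (f i y)) ≤ c * dist (g x) (g y))
    (hcov : ∀ x, ∃ i y, f i y = x) (hD : ∀ x y, dist (g x) (g y) ≤ D) (m : ℕ) :
    ∃ 𝒮 : Finset (Set X), 𝒮.card ≤ Fintype.card ι ^ m ∧ (∀ S ∈ 𝒮, IsPreconnected S ∧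
      ∀ x ∈ S, ∀ y ∈ S, dist (g x) (g y) ≤ c ^ m * D) ∧ ∀ x, ∃ S ∈ 𝒮, x ∈ S := by
  classical
  induction m with
  | zero =>
    refine ⟨{Set.univ}, by simp, ?_, fun x => ⟨Set.univ, by simp, trivial⟩⟩
    intro S hS
    rw [Finset.mem_singleton.1 hS]
    exact ⟨isPreconnected_univ, fun x _ y _ => by simpa using hD x y⟩
  | succ m ih =>
    obtain ⟨𝒮, hcard, h𝒮, hx⟩ := ih
    refine ⟨(Finset.univ ×ˢ 𝒮).image fun p => f p.1 '' p.2, ?_, ?_, ?_⟩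
    · refine Finset.card_image_le.trans ?_
      rw [Finset.card_product, Finset.card_univ, pow_succ']
      exact Nat.mul_le_mul_left _ hcard
    · intro S hS
      obtain ⟨⟨i, T⟩, hT, rfl⟩ := Finset.mem_image.1 hS
      obtain ⟨hTc, hTd⟩ := h𝒮 T (Finset.mem_product.1 hT).2
      refine ⟨hTc.image _ (hf i).continuousOn, ?_⟩
      rintro _ ⟨x, hx, rfl⟩ _ ⟨y, hy, rfl⟩
      refine (hfc i x y).trans ?_
      rw [pow_succ', mul_assoc]
      exact mul_le_mul_of_nonneg_left (hTd x hx y hy) hc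
    · intro x
      obtain ⟨i, y, rfl⟩ := hcov x
      obtain ⟨S, hS, hy⟩ := hx y
      exact ⟨f i '' S, Finset.mem_image.2 ⟨(i, S), by simpa using hS, rfl⟩, y, hy, rfl⟩

theorem exists_linear_lt_two_pow (A B : ℕ) : ∃ N, 1 ≤ N ∧ A * N + B < 2 ^ N := by
  refine ⟨2 * (2 * A + B + 1), by omega, ?_⟩
  have h : 2 * A + B + 1 < 2 ^ (2 * A + B + 1) := Nat.lt_two_pow_self
  rw [pow_mul', sq]
  nlinarith

/-- If `2^N` pairwise adjacent intervals join points at distance `δ`, one of them has ends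
at distance at least `δ / 2^N`. -/
theorem exists_dist_ge_div {Y : Type*} [PseudoMetricSpace Y] (γ : ℕ → Y) (N : ℕ) :
    ∃ i < 2 ^ N, dist (γ 0) (γ (2 ^ N)) / 2 ^ N ≤ dist (γ i) (γ (i + 1)) := by
  by_contra! h
  have h1 := dist_le_range_sum_dist γ (2 ^ N)
  have h2 : ∑ i ∈ Finset.range (2 ^ N), dist (γ i) (γ (i + 1)) <
      ∑ _i ∈ Finset.range (2 ^ N), dist (γ 0) (γ (2 ^ N)) / 2 ^ N :=
    Finset.sum_lt_sum_of_nonempty (by simp) fun i hi => h i (Finset.mem_range.1 hi)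
  rw [Finset.sum_const, Finset.card_range, nsmul_eq_mul] at h2
  push_cast at h2
  rw [mul_div_cancel₀ _ (by positivity)] at h2
  linarith

/-- A path between points at distance `≥ 2 ε` has a point at distance `≥ ε` from both ends. -/
theorem exists_dist_ge_of_path {Y : Type*} [PseudoMetricSpace Y] {γ : ℝ → Y} {a b ε : ℝ}
    (hab : a ≤ b) (hγ : ContinuousOn γ (Set.Icc a b)) (hε : 0 ≤ ε)
    (hd : 2 * ε ≤ dist (γ a) (γ b)) :
    ∃ t ∈ Set.Icc a b, ε ≤ dist (γ t) (γ a) ∧ ε ≤ dist (γ t) (γ b) := by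
  have hc : ContinuousOn (fun t => dist (γ t) (γ a)) (Set.Icc a b) :=
    continuous_dist.comp_continuousOn (hγ.prodMk continuousOn_const)
  obtain ⟨t, ht, hte⟩ := intermediate_value_Icc hab hc
    (show ε ∈ Set.Icc (dist (γ a) (γ a)) (dist (γ b) (γ a)) from
      ⟨by rwa [dist_self], by rw [dist_comm]; linarith⟩)
  dsimp only at hte
  refine ⟨t, ht, hte.ge, ?_⟩
  have := dist_triangle (γ a) (γ t) (γ b)
  rw [dist_comm (γ a) (γ t)] at this
  linarith

/-- Covering the shark teeth by connected sets of small diameter takes at least `2^(2^N)` sets. -/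
theorem two_pow_two_pow_le_card {Y : Type*} [MetricSpace Y] {g : sharkTeeth sharkExponent → Y}
    (hg : Continuous g) {N : ℕ} (hN : 1 ≤ N) {η : ℝ}
    (hη : 2 ^ (N + 1) * η < dist (g ⟨(0, 0), mem_sharkTeeth_bone ⟨le_rfl, zero_le_one⟩⟩)
      (g ⟨(1, 0), mem_sharkTeeth_bone ⟨zero_le_one, le_rfl⟩⟩))
    (𝒮 : Finset (Set (sharkTeeth sharkExponent))) (h𝒮 : ∀ S ∈ 𝒮, IsPreconnected S ∧
      ∀ x ∈ S, ∀ y ∈ S, dist (g x) (g y) ≤ η) (hcov : ∀ x, ∃ S ∈ 𝒮, x ∈ S) :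
    2 ^ 2 ^ N ≤ 𝒮.card := by
  have hp : (0 : ℝ) < 2 ^ N := by positivity
  let B : Set.Icc (0 : ℝ) 1 → sharkTeeth sharkExponent := fun t =>
    ⟨(t, 0), mem_sharkTeeth_bone t.2⟩
  -- The bone is cut into 2ᴺ equal intervals; `Set.projIcc` merely defines the sequence at all
  -- indices.
  obtain ⟨i, hi, hid⟩ := exists_dist_ge_div
    (fun i : ℕ => g (B (Set.projIcc 0 1 zero_le_one ((i : ℝ) / 2 ^ N)))) N
  have h0 : B (Set.projIcc 0 1 zero_le_one (((0 : ℕ) : ℝ) / 2 ^ N)) =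
      ⟨(0, 0), mem_sharkTeeth_bone ⟨le_rfl, zero_le_one⟩⟩ := by
    simp [B]
  have h1 : B (Set.projIcc 0 1 zero_le_one (((2 ^ N : ℕ) : ℝ) / 2 ^ N)) =
      ⟨(1, 0), mem_sharkTeeth_bone ⟨zero_le_one, le_rfl⟩⟩ := by
    simp [B]
  rw [h0, h1] at hid
  have hi' : (i : ℝ) + 1 ≤ 2 ^ N := by exact_mod_cast hi
  set a : ℝ := (i : ℝ) / 2 ^ N with ha_def
  set b : ℝ := ((i : ℝ) + 1) / 2 ^ N with hb_def
  have ha0 : 0 ≤ a := by positivity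
  have hb1 : b ≤ 1 := (div_le_one hp).2 hi'
  have hab : a ≤ b := div_le_div_of_nonneg_right (by linarith) hp.le
  have haI : a ∈ Set.Icc (0 : ℝ) 1 := ⟨ha0, hab.trans hb1⟩
  have hbI : b ∈ Set.Icc (0 : ℝ) 1 := ⟨ha0.trans hab, hb1⟩
  push_cast at hid
  rw [Set.projIcc_of_mem _ haI, ← hb_def, Set.projIcc_of_mem _ hbI] at hid
  set δ := dist (g ⟨(0, 0), mem_sharkTeeth_bone ⟨le_rfl, zero_le_one⟩⟩)
      (g ⟨(1, 0), mem_sharkTeeth_bone ⟨zero_le_one, le_rfl⟩⟩) with hδ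
  set ε := δ / 2 ^ N / 2 with hε
  have hε0 : 0 ≤ ε := by positivity
  have hηε : η < ε := by
    rw [hε, div_div, ← pow_succ, lt_div_iff₀ (by positivity), mul_comm]
    exact hη
  have hφa : scaledSawtooth N a = 0 := scaledSawtooth_div N i
  have hφb : scaledSawtooth N b = 0 := by
    have := scaledSawtooth_div N (i + 1)
    push_cast at this
    exact this
  -- Row 2^(2^N) + j joins the two ends over [a, b], so it has a point at image distance at least ε
  -- > η from both. The piece containing that point misses the ends.
  have hex : ∀ j < 2 ^ 2 ^ N, ∃ S ∈ 𝒮, B ⟨a, haI⟩ ∉ S ∧ B ⟨b, hbI⟩ ∉ S ∧ ∃ z ∈ S,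
      ∃ t ∈ Set.Ioo a b,
        (t, 1 / ((2 ^ 2 ^ N + j : ℕ) : ℝ) * scaledSawtooth N t) = (z : ℝ × ℝ) := by
    intro j hj
    set k := 2 ^ 2 ^ N + j with hk_def
    have hk : 1 ≤ k := Nat.one_le_two_pow.trans (Nat.le_add_right _ _)
    have hnk : sharkExponent k = N := sharkExponent_two_pow_add hN hj
    let R : ℝ → sharkTeeth sharkExponent := fun t =>
      ⟨_, mem_sharkTeeth_row hk (Set.projIcc (0 : ℝ) 1 zero_le_one t).2⟩
    have hRc : Continuous R := by
      refine Continuous.subtype_mk ?_ _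
      have hc : Continuous fun t : ℝ => ((Set.projIcc (0 : ℝ) 1 zero_le_one t : _) : ℝ) :=
        continuous_subtype_val.comp continuous_projIcc
      exact hc.prodMk (continuous_const.mul ((continuous_scaledSawtooth _).comp hc))
    have hR : ∀ t ∈ Set.Icc (0 : ℝ) 1, (R t : ℝ × ℝ) = (t, 1 / (k : ℝ) * scaledSawtooth N t) := by
      intro t ht
      simp only [R, hnk, Set.projIcc_of_mem _ ht]
    have hRa : R a = B ⟨a, haI⟩ := Subtype.ext (by rw [hR a haI, hφa, mul_zero])
    have hRb : R b = B ⟨b, hbI⟩ := Subtype.ext (by rw [hR b hbI, hφb, mul_zero])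
    obtain ⟨t, ht, hta, htb⟩ := exists_dist_ge_of_path (γ := fun t => g (R t)) hab
      (hg.comp hRc).continuousOn hε0 (by
        rw [hRa, hRb]
        refine le_trans (le_of_eq ?_) hid
        rw [hε]
        ring)
    obtain ⟨S, hS, htS⟩ := hcov (R t)
    have hnot : ∀ s, ε ≤ dist (g (R t)) (g (R s)) → R s ∉ S := fun s hs hsS =>
      absurd ((h𝒮 S hS).2 _ htS _ hsS) (not_le.2 (hηε.trans_le hs))
    have haS := hnot a hta
    have hbS := hnot b htb
    refine ⟨S, hS, hRa ▸ haS, hRb ▸ hbS, R t, htS, t, ⟨lt_of_le_of_ne ht.1 ?_,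
      lt_of_le_of_ne ht.2 ?_⟩, (hR t ⟨ha0.trans ht.1, ht.2.trans hb1⟩).symm⟩
    · rintro h
      exact haS (h ▸ htS)
    · rintro h
      exact hbS (h ▸ htS)
  have hne : ∀ j < 2 ^ 2 ^ N, ∀ j' < 2 ^ 2 ^ N, j < j' → ∀ S ∈ 𝒮,
      B ⟨a, haI⟩ ∉ S → B ⟨b, hbI⟩ ∉ S →
      (∃ z ∈ S, ∃ t ∈ Set.Ioo a b,
        (t, 1 / ((2 ^ 2 ^ N + j : ℕ) : ℝ) * scaledSawtooth N t) = (z : ℝ × ℝ)) →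
      ¬ ∃ z ∈ S, ∃ t ∈ Set.Ioo a b,
        (t, 1 / ((2 ^ 2 ^ N + j' : ℕ) : ℝ) * scaledSawtooth N t) = (z : ℝ × ℝ) := by
    rintro j hj j' hj' hjj' S hS haS hbS ⟨z, hz, t, ht, htz⟩ ⟨z', hz', t', ht', htz'⟩
    refine not_isPreconnected_of_mem_rows (n := sharkExponent) (N := N) (i := i)
      (k := 2 ^ 2 ^ N + j) (k' := 2 ^ 2 ^ N + j') (S := Subtype.val '' S) (t := t) (t' := t')
      (fun _ _ => sharkExponent_le) (Nat.one_le_two_pow.trans (Nat.le_add_right _ _)) (by omega)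
      (sharkExponent_two_pow_add hN hj) ?_ ?_ ?_ ?_ ?_ ⟨z, hz, htz.symm⟩ ⟨z', hz', htz'.symm⟩
      ((h𝒮 S hS).1.image _ continuous_subtype_val.continuousOn)
    · rintro _ ⟨w, -, rfl⟩
      exact w.2
    · rintro ⟨w, hw, hwa⟩
      exact haS ((Subtype.ext (by simpa using hwa) : w = B ⟨a, haI⟩) ▸ hw)
    · rintro ⟨w, hw, hwa⟩
      exact hbS ((Subtype.ext (by simpa using hwa) : w = B ⟨b, hbI⟩) ▸ hw)
    · simpa using ht
    · simpa using ht'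
  choose! S hS haS hbS hzS using hex
  rw [← Finset.card_range (2 ^ 2 ^ N)]
  refine Finset.card_le_card_of_injOn S (fun j hj => hS j (Finset.mem_range.1 hj)) ?_
  intro j hj j' hj' hjj'
  have hj := Finset.mem_range.1 hj
  have hj' := Finset.mem_range.1 hj'
  rcases lt_trichotomy j j' with h | h | h
  · exact (hne j hj j' hj' h (S j) (hS j hj) (haS j hj) (hbS j hj) (hzS j hj)
      (hjj' ▸ hzS j' hj')).elim
  · exact h
  · exact (hne j' hj' j hj h (S j) (hS j hj) (haS j hj) (hbS j hj) (hjj' ▸ hzS j' hj')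
      (hzS j hj)).elim

/-! ### No homeomorphism to an attractor. -/

theorem isEmpty_homeomorph_attractor {Y : Type*} [MetricSpace Y] {F : Set (Y → Y)} {A : Set Y}
    (hF : IsIFS F) (hA : IsAttractor F A) : IsEmpty (sharkTeeth sharkExponent ≃ₜ A) := by
  refine ⟨fun e => ?_⟩
  obtain ⟨hFfin, hFK⟩ := hF
  obtain ⟨-, hAc, hAF⟩ := hA
  obtain ⟨p, hp, hps⟩ := exists_path_onto_sharkTeeth tendsto_sharkExponent
  have hconn : PreconnectedSpace (sharkTeeth sharkExponent) :=
    ⟨hps.range_eq ▸ isPreconnected_range hp⟩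
  have := hFfin.fintype
  choose K hK using fun f : F => hFK f f.2
  have hmaps : ∀ (f : F) (y : A), (f : Y → Y) y ∈ A := fun f y => by
    refine hAF.superset ?_
    exact Set.mem_biUnion f.2 ⟨y, y.2, rfl⟩
  let g : sharkTeeth sharkExponent → Y := fun x => e x
  have hg : Continuous g := continuous_subtype_val.comp e.continuous
  let f : F → sharkTeeth sharkExponent → sharkTeeth sharkExponent := fun i x =>
    e.symm ⟨(i : Y → Y) (e x), hmaps i (e x)⟩
  have hfc : ∀ i, Continuous (f i) := fun i =>
    e.symm.continuous.comp (((hK i).2.continuous.comp hg).subtype_mk _)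
  have hgf : ∀ i x, g (f i x) = (i : Y → Y) (g x) := fun i x => by
    simp only [g, f, Homeomorph.apply_symm_apply]
  set c : NNReal := Finset.univ.sup K with hc
  have hc1 : c < 1 := (Finset.sup_lt_iff zero_lt_one).2 fun i _ => (hK i).1
  have hcontr : ∀ i x y, dist (g (f i x)) (g (f i y)) ≤ c * dist (g x) (g y) := fun i x y => by
    rw [hgf, hgf]
    refine ((hK i).2.dist_le_mul _ _).trans (mul_le_mul_of_nonneg_right ?_ dist_nonneg)
    exact_mod_cast Finset.le_sup (f := K) (Finset.mem_univ i)
  have hcov : ∀ x, ∃ i y, f i y = x := fun x => by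
    have hx : g x ∈ ⋃ f ∈ F, f '' A := hAF.subset (e x).2
    obtain ⟨i, hi, y, hy, hyx⟩ := Set.mem_iUnion₂.1 hx
    refine ⟨⟨i, hi⟩, e.symm ⟨y, hy⟩, e.injective (Subtype.ext ?_)⟩
    simp only [f, Homeomorph.apply_symm_apply]
    exact hyx
  have hD : ∀ x y, dist (g x) (g y) ≤ Metric.diam A := fun x y =>
    Metric.dist_le_diam_of_mem hAc.isBounded (e x).2 (e y).2
  set D := Metric.diam A
  set δ := dist (g ⟨(0, 0), mem_sharkTeeth_bone ⟨le_rfl, zero_le_one⟩⟩)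
      (g ⟨(1, 0), mem_sharkTeeth_bone ⟨zero_le_one, le_rfl⟩⟩) with hδ
  have hδ0 : 0 < δ := by
    refine dist_pos.2 fun h => ?_
    have := congrArg (fun z => (Subtype.val z).1) (e.injective (Subtype.ext h))
    norm_num at this
  -- Every r further iterations beat one halving of the dyadic scale, so rN of them absorb the
  -- factor 2ᴺ; the extra q iterations bring D below δ/2. Using D + 1 avoids dividing by zero.
  obtain ⟨r, hr⟩ := exists_pow_lt_of_lt_one (show (0 : ℝ) < 1 / 2 by norm_num)
    (show (c : ℝ) < 1 by exact_mod_cast hc1)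
  have hD0 : 0 ≤ D := Metric.diam_nonneg
  obtain ⟨q, hq⟩ := exists_pow_lt_of_lt_one (show (0 : ℝ) < δ / 2 / (D + 1) by positivity)
    (show (c : ℝ) < 1 by exact_mod_cast hc1)
  set s := Fintype.card F
  obtain ⟨N, hN, hlt⟩ := exists_linear_lt_two_pow (s * r) (s * q)
  obtain ⟨𝒮, hcard, h𝒮, h𝒮cov⟩ :=
    exists_cover_of_contractions c.2 hfc hcontr hcov hD (r * N + q)
  have hle : 2 ^ 2 ^ N ≤ 𝒮.card := by
    refine two_pow_two_pow_le_card hg hN ?_ 𝒮 h𝒮 h𝒮cov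
    have h1 : (c : ℝ) ^ q * D < δ / 2 := by
      rw [lt_div_iff₀ (by positivity)] at hq
      have : (c : ℝ) ^ q * D ≤ (c : ℝ) ^ q * (D + 1) :=
        mul_le_mul_of_nonneg_left (by linarith) (by positivity)
      linarith
    have h2 : (2 : ℝ) ^ N * (c : ℝ) ^ (r * N) ≤ 1 := by
      rw [pow_mul, ← mul_pow]
      exact pow_le_one₀ (by positivity) (by linarith)
    have h3 : (0 : ℝ) ≤ (c : ℝ) ^ q * D := by positivity
    calc (2 : ℝ) ^ (N + 1) * ((c : ℝ) ^ (r * N + q) * D)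
        = 2 * ((2 : ℝ) ^ N * (c : ℝ) ^ (r * N) * ((c : ℝ) ^ q * D)) := by
          rw [pow_succ, pow_add]
          ring
      _ ≤ 2 * ((c : ℝ) ^ q * D) := by
          exact mul_le_mul_of_nonneg_left (mul_le_of_le_one_left h3 h2) two_pos.le
      _ < δ := by linarith
  have hge : 𝒮.card < 2 ^ 2 ^ N := by
    calc 𝒮.card ≤ s ^ (r * N + q) := hcard
      -- The crude bound s ≤ 2ˢ makes the exponent linear in N, to be compared with 2ᴺ.
      _ ≤ (2 ^ s) ^ (r * N + q) := Nat.pow_le_pow_left Nat.lt_two_pow_self.le _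
      _ = 2 ^ (s * r * N + s * q) := by
          rw [← pow_mul]
          congr 1
          ring
      _ < 2 ^ 2 ^ N := Nat.pow_lt_pow_right one_lt_two hlt
  exact absurd hle (not_le.2 hge)

theorem mainTheorem2 :
    IsPeanoContinuum (sharkTeeth sharkExponent) ∧
    IsTopologicalFractal (sharkTeeth sharkExponent) ∧
    (∀ (Y : Type v) [MetricSpace Y] (F : Set (Y → Y)) (A : Set Y),
      IsIFS F → IsAttractor F A → IsEmpty (sharkTeeth sharkExponent ≃ₜ A)) ∧
    ¬ IsBanachFractal.{0, v} (sharkTeeth sharkExponent) := by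
  refine ⟨⟨inferInstance, exists_path_onto_sharkTeeth tendsto_sharkExponent⟩,
    isTopologicalFractal_sharkTeeth tendsto_sharkExponent sharkExponent_one,
    fun Y _ F A hF hA => isEmpty_homeomorph_attractor hF hA, ?_⟩
  rintro ⟨-, -, Y, _, _, F, A, hF, hA, ⟨e⟩⟩
  exact (isEmpty_homeomorph_attractor hF hA).false e
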